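/- Let $\mathcal H=\bigotimes_{k=1}^N\mathbb C^{d_k}$ with all $d_k\ge 1$, let $D=\dim\mathcal H$, let $\mathcal B=\{|\psi_i\rangle\}_{i=1}^{D}$ be an orthonormal basis of $\mathcal H$, and let $|\Phi\rangle\in\mathcal H'=\bigotimes_{k=1}^N\mathbb C^{d'_k}$ be a unit vector ($d'_k$ not necessarily equal to $d_k$). Denote by $|\Phi^*\rangle$ the entrywise complex conjugate of $|\Phi\rangle$ in the standard basis, and regard $\mathcal H'\otimes\mathcal H$ as an $N$-partite system whose $k$-th local subsystem is $\mathbb C^{d'_k}\otimes\mathbb C^{d_k}$. An LOCC protocol consists of finitely many rounds; in each round every party performs a local quantum operation with finitely many outcomes on its own subsystem (possibly changing its dimension, e.g. by adding ancillas or discarding parts) and broadcasts the outcome, later operations may depend on all earlier outcomes, and the protocol ends with a classical label determined by the outcomes. Suppose that the states $|\Phi\rangle\otimes|\psi_i\rangle$, $1\le i\le D$, can be perfectly distinguished by LOCC, i.e. there is an LOCC protocol with labels $1,\dots,D$ which on input $|\Phi\rangle\otimes|\psi_j\rangle$ ends with label $i$ with probability $\delta_{ij}$, for all $i,j$. Then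 there is an LOCC protocol, taking $\mathcal H'$ to $\mathcal H$, which converts $|\Phi^*\rangle$ to each of the $|\psi_i\rangle$ with probability $\frac1D$: for every $i$, on input $|\Phi^*\rangle$ it ends with label $i$ with probability exactly $\frac1D$, and in this case the final state is $|\psi_i\rangle$. -/

import Mathlib

open scoped Matrix

universe u

namespace LOCC

/-- Labels of the standard product basis of `⊗ₖ ℂ^(d k)`. -/
abbrev Idx {N : ℕ} (d : Fin N → ℕ) : Type := ∀ k, Fin (d k)

/-- The `N`-partite Hilbert space `⊗ₖ ℂ^(d k)`, in coordinates with respect to its standard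
product basis. -/
abbrev Space {N : ℕ} (d : Fin N → ℕ) : Type := EuclideanSpace ℂ (Idx d)

/-- The tensor product `⊗ₖ M k` of one local operator for each party. -/
def productOp {N : ℕ} {d e : Fin N → ℕ} (M : ∀ k, Matrix (Fin (e k)) (Fin (d k)) ℂ) :
    Matrix (Idx e) (Idx d) ℂ :=
  Matrix.of fun x y => ∏ k, M k (x k) (y k)

/-- An LOCC protocol (local operations and classical communication, with finitely many rounds)
for `N` parties, which takes a system with local dimensions `d` to a system with local dimensions
`out` and ends with a publicly known classical label in `L`.

In a round, every party `k` performs on its own subsystem a measurement with finitely many outcomes,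
given by Kraus operators `A k a` with `∑ a, (A k a)ᴴ * A k a = 1`, and broadcasts its outcome; the
rest of the protocol may depend on all the outcomes. The dimension of the subsystem may change, so
that adding an ancilla (an isometry, with one outcome) and discarding a subsystem (Kraus operators
`⟨j| ⊗ 1`) are included, and so are local unitaries, randomness, and the case that a party does
nothing. A general local instrument is obtained by announcing the index of the Kraus operator and
not using it afterwards: different branches may end with the same label, see `run`. -/
inductive Protocol {N : ℕ} (L : Type u) (out : Fin N → ℕ) : (Fin N → ℕ) → Type u
  | done (l : L) : Protocol L out out
  | round {d : Fin N → ℕ} (n : Fin N → ℕ) (e : ∀ k, Fin (n k) → ℕ)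
      (A : ∀ k (a : Fin (n k)), Matrix (Fin (e k a)) (Fin (d k)) ℂ)
      (complete : ∀ k, ∑ a, (A k a)ᴴ * A k a = 1)
      (next : ∀ a : Idx n, Protocol L out (fun k => e k (a k))) : Protocol L out d

/-- The quantum instrument implemented by a protocol: `P.run l ρ` is the subnormalized output state,
on the input state `ρ`, of the event that the protocol ends with label `l`. Its trace is the
probability of this event. -/
noncomputable def Protocol.run {N : ℕ} {L : Type u} [DecidableEq L] {out : Fin N → ℕ} (l : L) :
    {d : Fin N → ℕ} → Protocol L out d →
      Matrix (Idx d) (Idx d) ℂ → Matrix (Idx out) (Idx out) ℂ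
  | _, .done l', ρ => if l' = l then ρ else 0
  | _, .round _ _ A _ next, ρ =>
      ∑ a, (next a).run l
        (productOp (fun k => A k (a k)) * ρ * (productOp (fun k => A k (a k)))ᴴ)

/-- The rank-one operator `|φ⟩⟨φ|`. -/
def pureState {N : ℕ} {d : Fin N → ℕ} (φ : Space d) : Matrix (Idx d) (Idx d) ℂ :=
  Matrix.of fun x y => φ x * star (φ y)

/-- The entrywise complex conjugate in the standard basis. -/
noncomputable def conjState {N : ℕ} {d : Fin N → ℕ} (φ : Space d) : Space d :=
  WithLp.toLp 2 fun x => star (φ x)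

/-- `|Φ⟩ ⊗ |ψ⟩`, as a state of the `N`-partite system whose `k`-th local subsystem is
`ℂ^(d' k) ⊗ ℂ^(d k) = ℂ^(d' k * d k)`. -/
noncomputable def tensor {N : ℕ} {d' d : Fin N → ℕ} (Φ : Space d') (ψ : Space d) :
    Space (fun k => d' k * d k) :=
  WithLp.toLp 2 fun x =>
    Φ (fun k => (finProdFinEquiv.symm (x k)).1) * ψ (fun k => (finProdFinEquiv.symm (x k)).2)

/-- The states `φ i` can be perfectly distinguished by LOCC: some LOCC protocol, run on `φ j`,
reports the label `i` with probability `δ i j`. The quantum output is not used. -/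
def PerfectlyDistinguishable {N : ℕ} {ι : Type u} [DecidableEq ι] {d : Fin N → ℕ}
    (φ : ι → Space d) : Prop :=
  ∃ (out : Fin N → ℕ) (P : Protocol ι out d),
    ∀ i j, (P.run i (pureState (φ j))).trace = if i = j then 1 else 0

/-- The protocol converts `φ` into each `ψ i` with probability `p i`: with probability `p i` it
reports the label `i`, and the parties then share the state `ψ i`. -/
def Protocol.Converts {N : ℕ} {ι : Type u} [DecidableEq ι] {d out : Fin N → ℕ}
    (P : Protocol ι out d) (φ : Space d) (ψ : ι → Space out) (p : ι → ℝ) : Prop :=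
  ∀ i, P.run i (pureState φ) = (p i : ℂ) • pureState (ψ i)

end LOCC

namespace LOCC

open scoped ComplexOrder

variable {N : ℕ}

/-! Let `E i` be the POVM element of label `i`. Perfect discrimination says that the positive
operator `F i = ⟨Φ|E i|Φ⟩` on `H` has expectation `δ i j` in `ψ j`, which forces `F i = |ψ i⟩⟨ψ i|`
(`eq_pureState_of_diagonal`). To prepare these operators as states, each party adds a maximally
entangled pair of dimension `d k` to its share of `Φ*`. The complex conjugate of the protocol, run
on `Φ*` and the first halves, measures `(E i)ᵀ` (`run_conjOnFirst`). Steering through the entangled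
pairs undoes the transpose, so the second halves are left in `F i / D`
(`trace_effect_mul_block_addEntangled`). -/

/-- Regroup the labels of `⊗ₖ (ℂ^(d k) ⊗ ℂ^(b k))` as those of `(⊗ₖ ℂ^(d k)) ⊗ (⊗ₖ ℂ^(b k))`. -/
def regroup (d b : Fin N → ℕ) : Idx (fun k => d k * b k) ≃ Idx d × Idx b where
  toFun x := (fun k => (finProdFinEquiv.symm (x k)).1, fun k => (finProdFinEquiv.symm (x k)).2)
  invFun p := fun k => finProdFinEquiv (p.1 k, p.2 k)
  left_inv x := by
    funext k
    exact finProdFinEquiv.apply_symm_apply (x k)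
  right_inv p := by
    ext k <;> simp only [Equiv.symm_apply_apply]

/-- The tensor product of two local operators, with its indices encoded by `finProdFinEquiv`. -/
def localKron {m n p q : ℕ} (A : Matrix (Fin m) (Fin n) ℂ) (B : Matrix (Fin p) (Fin q) ℂ) :
    Matrix (Fin (m * p)) (Fin (n * q)) ℂ :=
  (Matrix.kronecker A B).submatrix finProdFinEquiv.symm finProdFinEquiv.symm

lemma localKron_conjTranspose_mul {m n p q : ℕ} (A : Matrix (Fin m) (Fin n) ℂ)
    (B : Matrix (Fin p) (Fin q) ℂ) :
    (localKron A B)ᴴ * localKron A B = localKron (Aᴴ * A) (Bᴴ * B) := by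
  unfold localKron
  rw [Matrix.conjTranspose_submatrix, Matrix.submatrix_mul_equiv]
  congr 1
  exact (congrArg (· * _) (Matrix.conjTranspose_kronecker A B)).trans
    (Matrix.mul_kronecker_mul Aᴴ A Bᴴ B).symm

lemma sum_localKron_left {m n p q : ℕ} {α : Type*} (s : Finset α)
    (A : α → Matrix (Fin m) (Fin n) ℂ) (B : Matrix (Fin p) (Fin q) ℂ) :
    ∑ a ∈ s, localKron (A a) B = localKron (∑ a ∈ s, A a) B := by
  ext i j
  simp [localKron, Matrix.sum_apply, Finset.sum_mul]

lemma localKron_one {m p : ℕ} :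
    localKron (1 : Matrix (Fin m) (Fin m) ℂ) (1 : Matrix (Fin p) (Fin p) ℂ) = 1 := by
  unfold localKron
  rw [show Matrix.kronecker (1 : Matrix (Fin m) (Fin m) ℂ) (1 : Matrix (Fin p) (Fin p) ℂ) = 1
    from Matrix.one_kronecker_one]
  exact Matrix.submatrix_one_equiv _

lemma productOp_localKron {d e b c : Fin N → ℕ} (A : ∀ k, Matrix (Fin (e k)) (Fin (d k)) ℂ)
    (B : ∀ k, Matrix (Fin (c k)) (Fin (b k)) ℂ) (x : Idx fun k => e k * c k)
    (y : Idx fun k => d k * b k) :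
    productOp (fun k => localKron (A k) (B k)) x y =
      productOp A (regroup e c x).1 (regroup d b y).1 *
        productOp B (regroup e c x).2 (regroup d b y).2 := by
  simp [productOp, localKron, regroup, Finset.prod_mul_distrib]

lemma productOp_one {d : Fin N → ℕ} :
    productOp (fun k => (1 : Matrix (Fin (d k)) (Fin (d k)) ℂ)) = 1 := by
  ext x y
  simp [productOp, Matrix.one_apply, Finset.prod_ite_zero, funext_iff]

lemma productOp_map_star {d e : Fin N → ℕ} (A : ∀ k, Matrix (Fin (e k)) (Fin (d k)) ℂ) :
    productOp (fun k => (A k).map star) = (productOp A).map star := by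
  ext x y
  simp [productOp]

/-- The block with label `(x, y)` of the second factor of an operator on a bipartite system. -/
def block {d b : Fin N → ℕ}
    (σ : Matrix (Idx fun k => d k * b k) (Idx fun k => d k * b k) ℂ) (x y : Idx b) :
    Matrix (Idx d) (Idx d) ℂ :=
  Matrix.of fun s t => σ ((regroup d b).symm (s, x)) ((regroup d b).symm (t, y))

/-- Operators `A ⊗ 1` do not touch the second labels, so each block evolves on its own. -/
lemma block_conj_localKron_one {d e b : Fin N → ℕ}
    (A : ∀ k, Matrix (Fin (e k)) (Fin (d k)) ℂ)
    (σ : Matrix (Idx fun k => d k * b k) (Idx fun k => d k * b k) ℂ) (x y : Idx b) :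
    block (productOp (fun k => localKron (A k) (1 : Matrix (Fin (b k)) (Fin (b k)) ℂ)) * σ *
      (productOp (fun k => localKron (A k) (1 : Matrix (Fin (b k)) (Fin (b k)) ℂ)))ᴴ) x y =
      productOp A * block σ x y * (productOp A)ᴴ := by
  ext s t
  simp only [block, Matrix.of_apply, Matrix.mul_apply, Matrix.conjTranspose_apply,
    productOp_localKron, productOp_one, Equiv.apply_symm_apply]
  rw [← (regroup d b).symm.sum_comp, Fintype.sum_prod_type]
  refine Finset.sum_congr rfl fun u _ => ?_
  rw [Finset.sum_eq_single y]
  · rw [← (regroup d b).symm.sum_comp, Fintype.sum_prod_type]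
    congr 1
    · refine Finset.sum_congr rfl fun v _ => ?_
      rw [Finset.sum_eq_single x]
      · simp [Matrix.one_apply]
      · intro z _ hz
        simp [hz.symm]
      · simp
    · simp [Matrix.one_apply]
  · intro z _ hz
    simp [Matrix.one_apply, hz.symm]
  · simp

/-! ### Effects of a protocol -/

namespace Protocol

variable {L : Type u} [DecidableEq L]

/-- The effect (POVM element) of the event that the protocol ends with label `l`. -/
noncomputable def effect {out : Fin N → ℕ} (l : L) :
    {d : Fin N → ℕ} → Protocol L out d → Matrix (Idx d) (Idx d) ℂ
  | _, .done l' => if l' = l then 1 else 0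
  | _, .round _ _ A _ next =>
      ∑ a, (productOp fun k => A k (a k))ᴴ * (next a).effect l * productOp fun k => A k (a k)

/-- Heisenberg picture: cyclicity of the trace moves the Kraus operators from the state to the
effect. -/
lemma trace_run {out : Fin N → ℕ} (l : L) {d : Fin N → ℕ} (P : Protocol L out d)
    (ρ : Matrix (Idx d) (Idx d) ℂ) : (P.run l ρ).trace = (P.effect l * ρ).trace := by
  induction P with
  | done l' => by_cases h : l' = l <;> simp [run, effect, h]
  | round n e A _ next ih =>
    simp only [run, effect, Matrix.trace_sum, Finset.sum_mul, ih]
    refine Finset.sum_congr rfl fun a _ => ?_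
    rw [← Matrix.mul_assoc, ← Matrix.mul_assoc, Matrix.trace_mul_comm]
    simp only [Matrix.mul_assoc]

lemma posSemidef_effect {out : Fin N → ℕ} (l : L) {d : Fin N → ℕ} (P : Protocol L out d) :
    (P.effect l).PosSemidef := by
  induction P with
  | done l' =>
    by_cases h : l' = l
    · simpa [effect, h] using Matrix.PosSemidef.one
    · simpa [effect, h] using Matrix.PosSemidef.zero
  | round n e A _ next ih =>
    exact Matrix.posSemidef_sum _ fun a _ => (ih a).conjTranspose_mul_mul_same _

end Protocol

/-! ### Partial trace and the conjugate protocol -/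

/-- The Kraus operator `⟨j| ⊗ 1` of discarding the first factor of a local subsystem. -/
def discard (m p : ℕ) (j : Fin m) : Matrix (Fin p) (Fin (m * p)) ℂ :=
  Matrix.of fun x z => if z = finProdFinEquiv (j, x) then 1 else 0

lemma sum_discard (m p : ℕ) : ∑ j, (discard m p j)ᴴ * discard m p j = 1 := by
  ext z w
  simp only [Matrix.sum_apply, Matrix.mul_apply, Matrix.conjTranspose_apply, discard,
    Matrix.of_apply]
  rw [← Fintype.sum_prod_type' (fun j x =>
    star (if z = finProdFinEquiv (j, x) then (1 : ℂ) else 0) *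
      if w = finProdFinEquiv (j, x) then 1 else 0), finProdFinEquiv.sum_comp
    (fun v => star (if z = v then (1 : ℂ) else 0) * if w = v then 1 else 0)]
  simp [Matrix.one_apply]

lemma productOp_discard {d b : Fin N → ℕ} (j : Idx d) (x : Idx b) (z : Idx fun k => d k * b k) :
    productOp (fun k => discard (d k) (b k) (j k)) x z =
      if z = (regroup d b).symm (j, x) then 1 else 0 := by
  simp [productOp, discard, Finset.prod_ite_zero, regroup, funext_iff]

/-- Forgetting the outcome `j` of the discarding measurement gives the partial trace over the first
factors. -/
lemma sum_discard_conj {d b : Fin N → ℕ}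
    (σ : Matrix (Idx fun k => d k * b k) (Idx fun k => d k * b k) ℂ) (x y : Idx b) :
    (∑ j : Idx d, productOp (fun k => discard (d k) (b k) (j k)) * σ *
      (productOp (fun k => discard (d k) (b k) (j k)))ᴴ) x y = (block σ x y).trace := by
  simp [Matrix.sum_apply, Matrix.mul_apply, productOp_discard, Matrix.trace, block]

namespace Protocol

variable {L : Type u}

/-- Run the complex conjugate of a protocol on the first factors of the local subsystems, and then
discard these, keeping the second factors. -/
noncomputable def conjOnFirst {out : Fin N → ℕ} (b : Fin N → ℕ) :
    {d : Fin N → ℕ} → Protocol L out d → Protocol L b (fun k => d k * b k)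
  | _, .done l =>
      -- Every outcome ends with the same label `l`, so `run` sums over them.
      .round out (fun k _ => b k) (fun k j => discard (out k) (b k) j)
        (fun k => sum_discard (out k) (b k)) (fun _ => .done l)
  | _, .round n e A complete next =>
      .round n (fun k a => e k a * b k) (fun k a => localKron ((A k a).map star) 1)
        (fun k => by
          have h : ∀ a, ((A k a).map star)ᴴ * (A k a).map star = ((A k a)ᴴ * A k a).map star := by
            intro a
            ext i j
            simp [Matrix.mul_apply]
          -- Completeness survives conjugation because the identity is real.
          have hs : ∑ a, ((A k a)ᴴ * A k a).map star = 1 := by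
            ext i j
            simp only [Matrix.sum_apply, Matrix.map_apply]
            rw [← star_sum, ← Matrix.sum_apply, complete k]
            by_cases hij : i = j <;> simp [Matrix.one_apply, hij]
          simp only [localKron_conjTranspose_mul, h, sum_localKron_left, hs,
            Matrix.conjTranspose_one, Matrix.mul_one, localKron_one])
        (fun a => (next a).conjOnFirst b)

/-- Transposing `Kᴴ * E * K` gives `Kᵀ * Eᵀ * K.map star`, and `Kᵀ` is the adjoint of `K.map star`:
conjugating the Kraus operators transposes the effect. -/
lemma run_conjOnFirst [DecidableEq L] {out : Fin N → ℕ} (b : Fin N → ℕ) (l : L) {d : Fin N → ℕ}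
    (P : Protocol L out d) (σ : Matrix (Idx fun k => d k * b k) (Idx fun k => d k * b k) ℂ)
    (x y : Idx b) :
    (P.conjOnFirst b).run l σ x y = ((P.effect l)ᵀ * block σ x y).trace := by
  induction P with
  | done l' =>
    by_cases h : l' = l
    · simp only [conjOnFirst, run, effect, h, if_true, Matrix.transpose_one, Matrix.one_mul]
      exact sum_discard_conj σ x y
    · simp [conjOnFirst, run, effect, h]
  | round n e A _ next ih =>
    simp only [conjOnFirst, run, effect, Matrix.sum_apply, Matrix.transpose_sum, Finset.sum_mul,
      Matrix.trace_sum]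
    refine Finset.sum_congr rfl fun a _ => ?_
    rw [ih, block_conj_localKron_one, productOp_map_star, ← Matrix.mul_assoc, Matrix.trace_mul_comm,
      ← Matrix.mul_assoc, ← Matrix.mul_assoc]
    congr 3
    simp only [Matrix.transpose_mul, ← Matrix.mul_assoc]
    congr 2
    ext i j
    simp

end Protocol

/-! ### Local maximally entangled states -/

/-- The isometry `ℂ^m → ℂ^m ⊗ ℂ^p ⊗ ℂ^p` which adds a maximally entangled state. -/
noncomputable def addEntangled (m p : ℕ) : Matrix (Fin (m * p * p)) (Fin m) ℂ :=
  Matrix.of fun z s =>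
    (if (finProdFinEquiv.symm (finProdFinEquiv.symm z).1).1 = s then 1 else 0) *
      (if (finProdFinEquiv.symm (finProdFinEquiv.symm z).1).2 = (finProdFinEquiv.symm z).2
        then ((√(p : ℝ) : ℝ) : ℂ)⁻¹ else 0)

lemma addEntangled_isometry (m : ℕ) {p : ℕ} (hp : 0 < p) :
    (addEntangled m p)ᴴ * addEntangled m p = 1 := by
  -- Each of the `p` diagonal labels contributes `1 / p` to the squared norm.
  have hc : ((√(p : ℝ) : ℝ) : ℂ)⁻¹ * ((√(p : ℝ) : ℝ) : ℂ)⁻¹ = (p : ℂ)⁻¹ := by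
    rw [← mul_inv, ← Complex.ofReal_mul, Real.mul_self_sqrt (Nat.cast_nonneg p),
      Complex.ofReal_natCast]
  have hp' : (p : ℂ) ≠ 0 := by exact_mod_cast hp.ne'
  ext s t
  simp only [Matrix.mul_apply, Matrix.conjTranspose_apply, addEntangled, Matrix.of_apply]
  rw [← finProdFinEquiv.sum_comp, Fintype.sum_prod_type, ← finProdFinEquiv.sum_comp,
    Fintype.sum_prod_type]
  simp only [Equiv.symm_apply_apply]
  by_cases h : s = t
  · subst h
    simp [hc, hp']
  · simp [h, Ne.symm h]

/-- The local pairs together form a maximally entangled state of two copies of the whole space. -/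
lemma productOp_addEntangled_mulVec {d b : Fin N → ℕ} (φ : Space d)
    (u : Idx d) (x y : Idx b) :
    (productOp fun k => addEntangled (d k) (b k)).mulVec φ
      ((regroup (fun k => d k * b k) b).symm ((regroup d b).symm (u, x), y)) =
      if x = y then (∏ k, ((√(b k : ℝ) : ℝ) : ℂ)⁻¹) * φ u else 0 := by
  have hext : ∀ {c : Fin N → ℕ} (f g : Idx c), (∀ k ∈ Finset.univ, f k = g k) ↔ f = g := by
    simp [funext_iff]
  simp only [Matrix.mulVec, dotProduct, productOp, addEntangled, Matrix.of_apply, regroup,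
    Equiv.coe_fn_symm_mk, Equiv.symm_apply_apply, Finset.prod_mul_distrib, Finset.prod_ite_zero,
    hext, Finset.prod_const_one]
  rw [Finset.sum_eq_single u]
  · by_cases h : x = y <;> simp [h]
  · intro s _ hs
    simp [hs.symm]
  · simp

lemma conj_pureState {d e : Fin N → ℕ} (K : Matrix (Idx e) (Idx d) ℂ) (φ : Space d) :
    K * pureState φ * Kᴴ = Matrix.of fun z w => K.mulVec φ z * star (K.mulVec φ w) := by
  have h : pureState φ = Matrix.vecMulVec φ (star (φ : Idx d → ℂ)) := rfl
  rw [h, Matrix.mul_vecMulVec, Matrix.vecMulVec_mul, ← Matrix.star_mulVec]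
  rfl

/-! ### Compression by `Φ` and rigidity of its diagonal -/

/-- The operator `⟨Φ|E|Φ⟩` on the second factor. -/
noncomputable def compress {d' d : Fin N → ℕ} (Φ : Space d')
    (E : Matrix (Idx fun k => d' k * d k) (Idx fun k => d' k * d k) ℂ) :
    Matrix (Idx d) (Idx d) ℂ :=
  -- `W` is the map `ψ ↦ Φ ⊗ ψ`; in the form `Wᴴ * E * W` positivity is immediate.
  let W : Matrix (Idx fun k => d' k * d k) (Idx d) ℂ :=
    Matrix.of fun z x => if (regroup d' d z).2 = x then Φ (regroup d' d z).1 else 0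
  Wᴴ * E * W

lemma compress_apply {d' d : Fin N → ℕ} (Φ : Space d')
    (E : Matrix (Idx fun k => d' k * d k) (Idx fun k => d' k * d k) ℂ) (x y : Idx d) :
    compress Φ E x y = ∑ t, ∑ s, star (Φ s) *
      E ((regroup d' d).symm (s, x)) ((regroup d' d).symm (t, y)) * Φ t := by
  simp only [compress, Matrix.mul_apply, Matrix.conjTranspose_apply, Matrix.of_apply]
  rw [← (regroup d' d).symm.sum_comp, Fintype.sum_prod_type]
  refine Finset.sum_congr rfl fun t _ => ?_
  rw [Finset.sum_eq_single y]
  · rw [← (regroup d' d).symm.sum_comp, Fintype.sum_prod_type, Finset.sum_mul]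
    refine Finset.sum_congr rfl fun s _ => ?_
    rw [Finset.sum_eq_single x]
    · simp
    · intro z _ hz
      simp [hz]
    · simp
  · intro z _ hz
    simp [hz]
  · simp

lemma posSemidef_compress {d' d : Fin N → ℕ} (Φ : Space d')
    {E : Matrix (Idx fun k => d' k * d k) (Idx fun k => d' k * d k) ℂ} (hE : E.PosSemidef) :
    (compress Φ E).PosSemidef :=
  hE.conjTranspose_mul_mul_same _

lemma trace_mul_pureState {d : Fin N → ℕ} (E : Matrix (Idx d) (Idx d) ℂ) (φ : Space d) :
    (E * pureState φ).trace = star (φ : Idx d → ℂ) ⬝ᵥ E.mulVec φ := by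
  have h : pureState φ = Matrix.vecMulVec φ (star (φ : Idx d → ℂ)) := rfl
  rw [h, Matrix.mul_vecMulVec, Matrix.trace_vecMulVec, dotProduct_comm]

lemma trace_mul_pureState_tensor {d' d : Fin N → ℕ} (Φ : Space d') (ψ : Space d)
    (E : Matrix (Idx fun k => d' k * d k) (Idx fun k => d' k * d k) ℂ) :
    (E * pureState (tensor Φ ψ)).trace = star (ψ : Idx d → ℂ) ⬝ᵥ (compress Φ E).mulVec ψ := by
  set W : Matrix (Idx fun k => d' k * d k) (Idx d) ℂ :=
    Matrix.of fun z x => if (regroup d' d z).2 = x then Φ (regroup d' d z).1 else 0 with hW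
  have ht : (tensor Φ ψ : Idx (fun k => d' k * d k) → ℂ) = W.mulVec ψ := by
    funext z
    simp only [hW, Matrix.mulVec, dotProduct, Matrix.of_apply, ite_mul, zero_mul,
      Finset.sum_ite_eq, Finset.mem_univ, if_true]
    rfl
  have hc : compress Φ E = Wᴴ * E * W := rfl
  rw [trace_mul_pureState, ht, hc, Matrix.star_mulVec, ← Matrix.dotProduct_mulVec,
    Matrix.mulVec_mulVec, Matrix.mulVec_mulVec, Matrix.mul_assoc]

/-- A positive semidefinite operator whose diagonal in an orthonormal basis is `δ i` is the
projection onto the `i`-th basis vector. -/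
lemma eq_pureState_of_diagonal {d : Fin N → ℕ} {ι : Type*} [Fintype ι] [DecidableEq ι]
    (ψ : OrthonormalBasis ι ℂ (Space d)) {F : Matrix (Idx d) (Idx d) ℂ} (hF : F.PosSemidef) (i : ι)
    (h : ∀ j, star (ψ j : Idx d → ℂ) ⬝ᵥ F.mulVec (ψ j) = if i = j then 1 else 0) :
    F = pureState (ψ i) := by
  have horth : ∀ j k, star (ψ j : Idx d → ℂ) ⬝ᵥ (ψ k : Idx d → ℂ) = if j = k then 1 else 0 := by
    intro j k
    rw [← orthonormal_iff_ite.mp ψ.orthonormal j k, EuclideanSpace.inner_eq_star_dotProduct,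
      dotProduct_comm]
  -- A positive operator with zero expectation in a vector annihilates it.
  have hker : ∀ j, i ≠ j → F.mulVec (ψ j) = 0 := fun j hj =>
    (hF.dotProduct_mulVec_zero_iff _).mp (by rw [h j, if_neg hj])
  have hpure : ∀ j, (pureState (ψ i)).mulVec (ψ j) = (if i = j then (1 : ℂ) else 0) •
      (ψ i : Idx d → ℂ) := by
    intro j
    have hp : pureState (ψ i) = Matrix.vecMulVec (ψ i) (star (ψ i : Idx d → ℂ)) := rfl
    rw [hp, Matrix.vecMulVec_mulVec, horth]
    ext x
    simp
  -- Since `F` is Hermitian, `⟨ψ j, F ψ i⟩ = ⟨F ψ j, ψ i⟩ = 0` for `j ≠ i`, and the `i`-th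
  -- coefficient is `1`.
  have hfix : F.mulVec (ψ i) = ψ i := by
    have : WithLp.toLp 2 (F.mulVec (ψ i)) = ψ i := by
      refine InnerProductSpace.ext_inner_left_basis ψ.toBasis fun j => ?_
      rw [OrthonormalBasis.coe_toBasis, orthonormal_iff_ite.mp ψ.orthonormal j i,
        EuclideanSpace.inner_eq_star_dotProduct, dotProduct_comm]
      by_cases hj : i = j
      · subst hj
        simpa using h i
      · rw [if_neg (Ne.symm hj), Matrix.dotProduct_mulVec]
        have := congrArg star (hker j hj)
        rw [Matrix.star_mulVec, hF.isHermitian.eq] at this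
        simp [this]
    exact congrArg WithLp.ofLp this
  have hlin : Matrix.toEuclideanLin F = Matrix.toEuclideanLin (pureState (ψ i)) := by
    refine ψ.toBasis.ext fun j => ?_
    rw [OrthonormalBasis.coe_toBasis, Matrix.toLpLin_apply, Matrix.toLpLin_apply,
      hpure]
    by_cases hj : i = j
    · subst hj
      simp [hfix]
    · simp [hj, hker j hj]
  exact Matrix.toEuclideanLin.injective hlin

/-- The source of the probability `1 / D`: the squared amplitude of the pairs, with `D = ∏ k, b k`.
-/
lemma prod_inv_sqrt_mul_star {b : Fin N → ℕ} :
    (∏ k, ((√(b k : ℝ) : ℝ) : ℂ)⁻¹) * star (∏ k, ((√(b k : ℝ) : ℝ) : ℂ)⁻¹) =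
      ((1 / (Module.finrank ℂ (Space b) : ℝ) : ℝ) : ℂ) := by
  rw [finrank_euclideanSpace, star_prod, ← Finset.prod_mul_distrib, Fintype.card_pi]
  push_cast
  rw [one_div, ← Finset.prod_inv_distrib]
  refine Finset.prod_congr rfl fun k _ => ?_
  rw [Fintype.card_fin, star_inv₀, Complex.star_def, Complex.conj_ofReal, ← mul_inv,
    ← Complex.ofReal_mul, Real.mul_self_sqrt (Nat.cast_nonneg _), Complex.ofReal_natCast]

/-- Applying the transpose of `E` to `Φ*` and one half of a maximally entangled state steers the
other half to `⟨Φ|E|Φ⟩`, up to the factor `1 / D`. -/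
lemma trace_effect_mul_block_addEntangled {d' d : Fin N → ℕ} (Φ : Space d')
    (E : Matrix (Idx fun k => d' k * d k) (Idx fun k => d' k * d k) ℂ) (x y : Idx d) :
    (Eᵀ * block (productOp (fun k => addEntangled (d' k) (d k)) * pureState (conjState Φ) *
      (productOp fun k => addEntangled (d' k) (d k))ᴴ) x y).trace =
      ((1 / (Module.finrank ℂ (Space d) : ℝ) : ℝ) : ℂ) * compress Φ E x y := by
  rw [conj_pureState, compress_apply, ← prod_inv_sqrt_mul_star, Matrix.trace]
  simp only [Matrix.diag_apply, Matrix.mul_apply, Matrix.transpose_apply, block, Matrix.of_apply]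
  rw [← (regroup d' d).symm.sum_comp, Fintype.sum_prod_type, Finset.mul_sum]
  refine Finset.sum_congr rfl fun t _ => ?_
  rw [Finset.sum_eq_single y]
  · rw [← (regroup d' d).symm.sum_comp, Fintype.sum_prod_type, Finset.mul_sum]
    refine Finset.sum_congr rfl fun s _ => ?_
    rw [Finset.sum_eq_single x]
    · simp only [productOp_addEntangled_mulVec, if_true]
      simp only [conjState, star_mul, star_star]
      ring
    · intro z _ hz
      simp [productOp_addEntangled_mulVec, hz]
    · simp
  · intro z _ hz
    simp [productOp_addEntangled_mulVec, hz]
  · simp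

end LOCC

theorem corollary1 {N : ℕ} {d d' : Fin N → ℕ} (hd : ∀ k, 0 < d k)
    {ι : Type u} [Fintype ι] [DecidableEq ι]
    (ψ : OrthonormalBasis ι ℂ (LOCC.Space d))
    (Φ : LOCC.Space d') (hΦ : ‖Φ‖ = 1)
    (h : LOCC.PerfectlyDistinguishable (fun i => LOCC.tensor Φ (ψ i))) :
    ∃ P : LOCC.Protocol ι d d',
      P.Converts (LOCC.conjState Φ) ψ (fun _ => 1 / (Module.finrank ℂ (LOCC.Space d) : ℝ)) := by
  obtain ⟨out, P, hP⟩ := h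
  -- The opening round has a single outcome: every party adds its entangled pair.
  refine ⟨.round (fun _ => 1) (fun k _ => d' k * d k * d k)
    (fun k _ => LOCC.addEntangled (d' k) (d k))
    (fun k => by simpa using LOCC.addEntangled_isometry (d' k) (hd k))
    (fun _ => P.conjOnFirst d), fun i => ?_⟩
  have hF : LOCC.compress Φ (P.effect i) = LOCC.pureState (ψ i) :=
    LOCC.eq_pureState_of_diagonal ψ (LOCC.posSemidef_compress Φ (P.posSemidef_effect i)) i
      fun j => by rw [← LOCC.trace_mul_pureState_tensor, ← P.trace_run, hP]
  ext x y
  simp only [LOCC.Protocol.run, Fintype.sum_unique]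
  rw [LOCC.Protocol.run_conjOnFirst, LOCC.trace_effect_mul_block_addEntangled, hF]
  rfl
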